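/- Let $\Gamma$ be a discrete group with left regular representation $\lambda\colon \mathbb{C}\Gamma\to \mathbb{B}(\ell^2(\Gamma))$, given by $(\lambda(g)\xi)(h)=\xi(g^{-1}h)$ for $g,h\in\Gamma$. Let $L\Gamma=\lambda(\mathbb{C}\Gamma)''\subseteq \mathbb{B}(\ell^2(\Gamma))$ be its group von Neumann algebra, $Z(L\Gamma)$ the centre of $L\Gamma$, and $\tau(x)=\langle x\delta_e,\delta_e\rangle$ the canonical trace. The central granularity of $\Gamma$ is $$\sigma(\Gamma)=\inf\{\tau(p)\mid p\in Z(L\Gamma)\text{ an orthogonal projection},\ p\neq 0\}\in[0,1].$$ Let $\Gamma_{\mathrm{fc}}$ be the FC-centre of $\Gamma$, that is, the normal subgroup of all elements of $\Gamma$ with finite conjugacy class. Then: (i) if $\Gamma_{\mathrm{fc}}$ is finite, then $\sigma(\Gamma)=\frac{1}{|\Gamma_{\mathrm{fc}}|}$; (ii) if $\Gamma_{\mathrm{fc}}$ contains an infinite finitely generated subgroup, then $\sigma(\Gamma)=0$. -/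

import Mathlib

open scoped ENNReal

noncomputable section

/-- The FC-centre of a group: the subgroup of all elements whose conjugacy class is finite. -/
def fcCenter (Γ : Type*) [Group Γ] : Subgroup Γ where
  carrier := {g | (conjugatesOf g).Finite}
  one_mem' := by
    refine (Set.finite_singleton (1 : Γ)).subset ?_
    intro x hx
    obtain ⟨c, rfl⟩ := isConj_iff.1 (show IsConj _ _ from hx)
    simp
  mul_mem' := by
    intro a b ha hb
    refine (Set.Finite.mul (s := conjugatesOf a) (t := conjugatesOf b) ha hb).subset ?_
    intro x hx
    obtain ⟨c, rfl⟩ := isConj_iff.1 (show IsConj _ _ from hx)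
    exact Set.mem_mul.2 ⟨c * a * c⁻¹, isConj_iff.2 ⟨c, rfl⟩,
      c * b * c⁻¹, isConj_iff.2 ⟨c, rfl⟩, by group⟩
  inv_mem' := by
    intro a ha
    refine (Set.Finite.inv (s := conjugatesOf a) ha).subset ?_
    intro x hx
    obtain ⟨c, rfl⟩ := isConj_iff.1 (show IsConj _ _ from hx)
    exact Set.mem_inv.2 (isConj_iff.2 ⟨c, by group⟩)

/-- The Hilbert space `ℓ²(Γ)` of square-summable functions `Γ → ℂ`. -/
abbrev GroupL2 (Γ : Type*) : Type _ := lp (fun _ : Γ => ℂ) 2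

/-- Left translation by `g` on `ℓ²(Γ)`: `(λ_g ξ)(h) = ξ(g⁻¹ h)`. -/
def leftTranslation {Γ : Type*} [Group Γ] (g : Γ) : GroupL2 Γ →ₗᵢ[ℂ] GroupL2 Γ where
  toFun ξ := ⟨fun h => ξ (g⁻¹ * h), by
    have h2 : (0 : ℝ) < (2 : ℝ≥0∞).toReal := by norm_num
    exact (memℓp_gen_iff h2).2
      ((Equiv.mulLeft g⁻¹).summable_iff.2 ((memℓp_gen_iff h2).1 (lp.memℓp ξ)))⟩
  map_add' _ _ := rfl
  map_smul' _ _ := rfl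
  norm_map' ξ := by
    have h2 : (0 : ℝ) < (2 : ℝ≥0∞).toReal := by norm_num
    rw [lp.norm_eq_tsum_rpow h2, lp.norm_eq_tsum_rpow h2]
    congr 1
    exact (Equiv.mulLeft g⁻¹).tsum_eq (fun h => ‖ξ h‖ ^ (2 : ℝ≥0∞).toReal)

/-- The left regular representation of `Γ` on `ℓ²(Γ)`. -/
def leftRegular (Γ : Type*) [Group Γ] : Γ →* (GroupL2 Γ →L[ℂ] GroupL2 Γ) where
  toFun g := (leftTranslation g).toContinuousLinearMap
  map_one' := by
    ext ξ h
    change ξ (1⁻¹ * h) = ξ h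
    simp
  map_mul' a b := by
    ext ξ h
    change ξ ((a * b)⁻¹ * h) = ξ (b⁻¹ * (a⁻¹ * h))
    simp [mul_assoc]

/-- The linear extension `λ : ℂΓ → B(ℓ²(Γ))` of the left regular representation. -/
def leftRegularAlg (Γ : Type*) [Group Γ] :
    MonoidAlgebra ℂ Γ →ₐ[ℂ] (GroupL2 Γ →L[ℂ] GroupL2 Γ) :=
  MonoidAlgebra.lift ℂ (GroupL2 Γ →L[ℂ] GroupL2 Γ) Γ (leftRegular Γ)

/-- The group von Neumann algebra `LΓ = (λ(ℂΓ))''`, the double commutant of `λ(ℂΓ)` in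
`B(ℓ²(Γ))`. -/
def groupVN (Γ : Type*) [Group Γ] : VonNeumannAlgebra (GroupL2 Γ) where
  toStarSubalgebra := StarSubalgebra.centralizer ℂ
    (StarSubalgebra.centralizer ℂ (Set.range (leftRegularAlg Γ)) :
      Set (GroupL2 Γ →L[ℂ] GroupL2 Γ))
  centralizer_centralizer' := by
    change Set.centralizer (Set.centralizer (StarSubalgebra.centralizer ℂ
      (StarSubalgebra.centralizer ℂ (Set.range (leftRegularAlg Γ)) :
        Set (GroupL2 Γ →L[ℂ] GroupL2 Γ)) : Set (GroupL2 Γ →L[ℂ] GroupL2 Γ))) =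
      (StarSubalgebra.centralizer ℂ
      (StarSubalgebra.centralizer ℂ (Set.range (leftRegularAlg Γ)) :
        Set (GroupL2 Γ →L[ℂ] GroupL2 Γ)) : Set (GroupL2 Γ →L[ℂ] GroupL2 Γ))
    rw [StarSubalgebra.coe_centralizer_centralizer, Set.centralizer_centralizer_centralizer]

/-- The centre `Z(M) = M ∩ M'` of a von Neumann algebra `M`. -/
def vnCenter {H : Type*} [NormedAddCommGroup H] [InnerProductSpace ℂ H] [CompleteSpace H]
    (M : VonNeumannAlgebra H) : StarSubalgebra ℂ (H →L[ℂ] H) :=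
  M.toStarSubalgebra ⊓ M.commutant.toStarSubalgebra

/-- The unit vector `δ_e` of `ℓ²(Γ)` at the neutral element. -/
def deltaOne (Γ : Type*) [Group Γ] : GroupL2 Γ :=
  letI := Classical.decEq Γ
  lp.single 2 (1 : Γ) (1 : ℂ)

/-- The canonical trace `τ(x) = ⟨x δ_e, δ_e⟩`; Mathlib's inner product is linear in its second
argument. -/
def groupTrace {Γ : Type*} [Group Γ] (x : GroupL2 Γ →L[ℂ] GroupL2 Γ) : ℂ :=
  inner ℂ (deltaOne Γ) (x (deltaOne Γ))

/-- The trace of an orthogonal projection is the real number `‖p δ_e‖²`. -/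
theorem groupTrace_proj {Γ : Type*} [Group Γ] {p : GroupL2 Γ →L[ℂ] GroupL2 Γ}
    (hp : IsStarProjection p) : groupTrace p = ((‖p (deltaOne Γ)‖ ^ 2 : ℝ) : ℂ) := by
  have h1 : p (deltaOne Γ) = p (p (deltaOne Γ)) := by
    conv_lhs => rw [← hp.isIdempotentElem.eq]
    rfl
  have h2 : ContinuousLinearMap.adjoint p = p := hp.isSelfAdjoint
  have h3 := ContinuousLinearMap.adjoint_inner_left p (p (deltaOne Γ)) (deltaOne Γ)
  rw [h2] at h3
  rw [groupTrace, h1, ← h3, inner_self_eq_norm_sq_to_K, ← h1]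
  norm_cast

/-- The set of traces `τ(p)` of the nonzero projections `p` in the centre of `LΓ`. -/
def centralTraces (Γ : Type*) [Group Γ] : Set ℝ :=
  {r | ∃ p ∈ vnCenter (groupVN Γ), IsStarProjection p ∧ p ≠ 0 ∧ groupTrace p = (r : ℂ)}

/-- The central granularity `σ(Γ) = inf {τ(p) | p ∈ Proj(Z(LΓ)), p ≠ 0}`. -/
def centralGranularity (Γ : Type*) [Group Γ] : ℝ :=
  sInf (centralTraces Γ)

/-- The infimum is over a nonempty set, which contains `τ(1) = 1`. -/
theorem one_mem_centralTraces (Γ : Type*) [Group Γ] : (1 : ℝ) ∈ centralTraces Γ := by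
  classical
  have hn : ‖deltaOne Γ‖ = 1 := by
    unfold deltaOne
    rw [lp.norm_single (by norm_num)]
    simp
  refine ⟨1, one_mem _, .one _, ?_, ?_⟩
  · intro h
    have h0 : deltaOne Γ = 0 := by simpa using congrArg (fun T => T (deltaOne Γ)) h
    simp [h0] at hn
  · rw [groupTrace_proj (.one _)]
    simp [hn]

/-- The infimum is over a set that is bounded below by `0`. -/
theorem centralTraces_nonneg {Γ : Type*} [Group Γ] {r : ℝ} (hr : r ∈ centralTraces Γ) :
    0 ≤ r := by
  obtain ⟨p, -, hp, -, h⟩ := hr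
  rw [groupTrace_proj hp] at h
  rw [← Complex.ofReal_injective h]
  positivity

end

open scoped ENNReal

noncomputable section

/-! ### Translations and commutants on `ℓ²(Γ)` -/

section RegularRepresentation

variable {Γ : Type*} [Group Γ]

/-! Finite FC-centre of order `n`: for a central projection `p ≠ 0`, the vector `ξ = p δ_e` is an
`ℓ²` class function, hence supported on the FC-centre. Its coefficients are `⟨ρ ξ, ξ⟩` for right
translations `ρ`, so `|ξ(g)| ≤ ‖ξ‖²` and `‖ξ‖² ≤ n ‖ξ‖⁴`, which gives `τ(p) = ‖ξ‖² ≥ 1/n`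
(`centralTraces_lower_bound`). The average of `λ` over the FC-centre attains the bound.

Infinite finitely generated `Λ` in the FC-centre: enlarge its generators to a finite symmetric
conjugation-invariant set `S`. Then `T = ∑_{x ∈ S} λ(x)` is central and self-adjoint, and its powers
span an infinite-dimensional space since `T ^ n δ_e` has support exactly `S ^ n`. So `T` has
infinite spectrum, hence arbitrarily many orthogonal nonzero central projections, whose traces sum
to at most `1`. -/

theorem leftRegular_apply (g : Γ) (ξ : GroupL2 Γ) (h : Γ) :
    leftRegular Γ g ξ h = ξ (g⁻¹ * h) := rfl

/-- Right translation by `g` on `ℓ²(Γ)`: `(ρ_g ξ)(h) = ξ(h g)`. -/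
def rightTranslation (g : Γ) : GroupL2 Γ →ₗᵢ[ℂ] GroupL2 Γ where
  toFun ξ := ⟨fun h => ξ (h * g), by
    have h2 : (0 : ℝ) < (2 : ℝ≥0∞).toReal := by norm_num
    exact (memℓp_gen_iff h2).2
      ((Equiv.mulRight g).summable_iff.2 ((memℓp_gen_iff h2).1 (lp.memℓp ξ)))⟩
  map_add' _ _ := rfl
  map_smul' _ _ := rfl
  norm_map' ξ := by
    have h2 : (0 : ℝ) < (2 : ℝ≥0∞).toReal := by norm_num
    rw [lp.norm_eq_tsum_rpow h2, lp.norm_eq_tsum_rpow h2]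
    congr 1
    exact (Equiv.mulRight g).tsum_eq (fun h => ‖ξ h‖ ^ (2 : ℝ≥0∞).toReal)

/-- Right translation as a bounded operator. -/
def rightRegular (g : Γ) : GroupL2 Γ →L[ℂ] GroupL2 Γ :=
  (rightTranslation g).toContinuousLinearMap

theorem rightRegular_apply (g : Γ) (ξ : GroupL2 Γ) (h : Γ) :
    rightRegular g ξ h = ξ (h * g) := rfl

theorem norm_rightRegular (g : Γ) (ξ : GroupL2 Γ) : ‖rightRegular g ξ‖ = ‖ξ‖ :=
  (rightTranslation g).norm_map ξ

theorem star_leftRegular (g : Γ) : star (leftRegular Γ g) = leftRegular Γ g⁻¹ := by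
  rw [ContinuousLinearMap.star_eq_adjoint]
  symm
  rw [ContinuousLinearMap.eq_adjoint_iff]
  intro ξ η
  rw [lp.inner_eq_tsum, lp.inner_eq_tsum, ← (Equiv.mulLeft g⁻¹).tsum_eq]
  refine tsum_congr fun h => ?_
  simp [leftRegular_apply]

theorem deltaOne_apply [DecidableEq Γ] (h : Γ) :
    deltaOne Γ h = if h = 1 then 1 else 0 := by
  rw [deltaOne, Subsingleton.elim (Classical.decEq Γ) ‹_›, lp.single_apply, Pi.single_apply]

theorem norm_deltaOne : ‖deltaOne Γ‖ = 1 := by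
  classical
  unfold deltaOne
  rw [lp.norm_single (by norm_num)]
  simp

theorem inner_rightRegular_deltaOne (g : Γ) (ξ : GroupL2 Γ) :
    inner ℂ (rightRegular g⁻¹ (deltaOne Γ)) ξ = ξ g := by
  classical
  have : rightRegular g⁻¹ (deltaOne Γ) = lp.single 2 g (1 : ℂ) := by
    ext h
    rw [rightRegular_apply, deltaOne_apply, lp.single_apply, Pi.single_apply]
    simp [mul_inv_eq_one]
  rw [this, lp.inner_single_left]
  simp

/-- The commutant `λ(ℂΓ)'` of the left regular representation. -/
def leftCommutant (Γ : Type*) [Group Γ] : StarSubalgebra ℂ (GroupL2 Γ →L[ℂ] GroupL2 Γ) :=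
  StarSubalgebra.centralizer ℂ (Set.range (leftRegularAlg Γ))

theorem mem_leftCommutant_iff {x : GroupL2 Γ →L[ℂ] GroupL2 Γ} :
    x ∈ leftCommutant Γ ↔ ∀ g, Commute (leftRegular Γ g) x := by
  have hsingle (g : Γ) (c : ℂ) :
      leftRegularAlg Γ (MonoidAlgebra.single g c) = c • leftRegular Γ g := by
    simp [leftRegularAlg, MonoidAlgebra.lift_single]
  rw [leftCommutant, StarSubalgebra.mem_centralizer_iff]
  constructor
  · intro hx g
    have := (hx _ ⟨MonoidAlgebra.single g 1, rfl⟩).1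
    rwa [hsingle, one_smul] at this
  · rintro hx _ ⟨a, rfl⟩
    change Commute _ _ ∧ Commute _ _
    induction a using MonoidAlgebra.induction_linear with
    | zero => simp
    | add a b ha hb =>
      rw [map_add, star_add]
      exact ⟨ha.1.add_left hb.1, ha.2.add_left hb.2⟩
    | single g c =>
      rw [hsingle, star_smul, star_leftRegular]
      exact ⟨(hx g).smul_left c, (hx g⁻¹).smul_left _⟩

theorem rightRegular_mem_leftCommutant (g : Γ) : rightRegular g ∈ leftCommutant Γ := by
  rw [mem_leftCommutant_iff]
  intro k
  ext ξ h
  change ξ (k⁻¹ * h * g) = ξ (k⁻¹ * (h * g))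
  rw [mul_assoc]

/-- The triple commutant is the commutant, so the centre is `λ(ℂΓ)' ∩ λ(ℂΓ)''`. -/
theorem mem_vnCenter_groupVN_iff {x : GroupL2 Γ →L[ℂ] GroupL2 Γ} :
    x ∈ vnCenter (groupVN Γ) ↔
      x ∈ leftCommutant Γ ∧ ∀ y ∈ leftCommutant Γ, Commute y x := by
  have h1 : x ∈ (groupVN Γ).toStarSubalgebra ↔ ∀ y ∈ leftCommutant Γ, Commute y x := by
    change x ∈ StarSubalgebra.centralizer ℂ (leftCommutant Γ : Set _) ↔ _
    rw [StarSubalgebra.mem_centralizer_iff]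
    exact ⟨fun h y hy => (h y hy).1, fun h y hy => ⟨h y hy, h _ (star_mem hy)⟩⟩
  have h2 : x ∈ (groupVN Γ).commutant.toStarSubalgebra ↔ x ∈ leftCommutant Γ := by
    change x ∈ (groupVN Γ).commutant ↔ _
    rw [← SetLike.mem_coe, VonNeumannAlgebra.coe_commutant,
      ← SetLike.mem_coe (A := StarSubalgebra ℂ _)]
    have h3 : ((groupVN Γ : VonNeumannAlgebra _) : Set (GroupL2 Γ →L[ℂ] GroupL2 Γ)) =
        (Set.range (leftRegularAlg Γ) ∪
          star (Set.range (leftRegularAlg Γ))).centralizer.centralizer :=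
      StarSubalgebra.coe_centralizer_centralizer ℂ _
    rw [h3, Set.centralizer_centralizer_centralizer]
    rfl
  change _ ∧ _ ↔ _
  rw [and_comm]
  exact and_congr h2 h1

end RegularRepresentation

/-! ### Sums of `λ` over finite sets and growth of their powers -/

section ClassSum

variable {Γ : Type*} [Group Γ]

/-- The operator `∑_{x ∈ S} λ(x)`. -/
def leftSum (S : Finset Γ) : GroupL2 Γ →L[ℂ] GroupL2 Γ := ∑ x ∈ S, leftRegular Γ x

theorem leftSum_apply (S : Finset Γ) (ξ : GroupL2 Γ) (h : Γ) :
    leftSum S ξ h = ∑ x ∈ S, ξ (x⁻¹ * h) := by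
  rw [leftSum, _root_.sum_apply, lp.coeFn_sum, Finset.sum_apply]
  rfl

theorem leftSum_mem_vnCenter {S : Finset Γ} (hS : ∀ g, ∀ x ∈ S, g * x * g⁻¹ ∈ S) :
    leftSum S ∈ vnCenter (groupVN Γ) := by
  rw [mem_vnCenter_groupVN_iff]
  constructor
  · rw [mem_leftCommutant_iff]
    intro g
    change _ * _ = _ * _
    rw [leftSum, Finset.mul_sum, Finset.sum_mul]
    refine Finset.sum_nbij' (fun x => g * x * g⁻¹) (fun x => g⁻¹ * x * g) (hS g)
      (fun x hx => by simpa using hS g⁻¹ x hx) (fun x _ => by group) (fun x _ => by group)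
      fun x _ => ?_
    rw [← map_mul, ← map_mul]
    congr 1
    group
  · intro y hy
    exact Commute.sum_right _ _ _ fun x _ => (mem_leftCommutant_iff.1 hy x).symm

theorem isSelfAdjoint_leftSum {S : Finset Γ} (hS : ∀ x ∈ S, x⁻¹ ∈ S) :
    IsSelfAdjoint (leftSum S) := by
  rw [IsSelfAdjoint, leftSum, star_sum]
  refine Finset.sum_nbij' (fun x => x⁻¹) (fun x => x⁻¹) hS hS (fun x _ => inv_inv x)
    (fun x _ => inv_inv x) fun x _ => star_leftRegular x

open scoped Pointwise in
-- The coefficient at `h` counts the words of length `n` in `S` with product `h`; counts are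
-- nonnegative, so nothing cancels.
theorem leftSum_pow_deltaOne_apply (S : Finset Γ) (n : ℕ) (h : Γ) :
    ∃ k : ℕ, (leftSum S ^ n) (deltaOne Γ) h = k ∧ (k ≠ 0 ↔ h ∈ (S : Set Γ) ^ n) := by
  classical
  induction n generalizing h with
  | zero =>
    refine ⟨if h = 1 then 1 else 0, ?_, ?_⟩
    · rw [pow_zero, one_apply_eq_self, deltaOne_apply]
      simp
    · simp
  | succ n ih =>
    choose k hk hk' using ih
    refine ⟨∑ x ∈ S, k (x⁻¹ * h), ?_, ?_⟩
    · rw [pow_succ', mul_apply_eq_comp, leftSum_apply]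
      simp_rw [hk]
      push_cast
      rfl
    · rw [Ne, Finset.sum_eq_zero_iff, pow_succ', Set.mem_mul]
      push Not
      constructor
      · rintro ⟨x, hx, h0⟩
        exact ⟨x, hx, _, (hk' _).1 h0, by group⟩
      · rintro ⟨x, hx, y, hy, rfl⟩
        exact ⟨x, hx, (hk' _).2 (by simpa using hy)⟩

open scoped Pointwise in
theorem not_powers_mem_span_leftSum {S : Finset Γ} (hinv : ∀ x ∈ S, x⁻¹ ∈ S)
    (hinf : Infinite (Subgroup.closure (S : Set Γ))) :
    ¬ ∃ d : ℕ, ∀ n, ∃ c : ℕ → ℂ, leftSum S ^ n = ∑ i ∈ Finset.range d, c i • leftSum S ^ i := by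
  rintro ⟨d, hpow⟩
  have hsub (n : ℕ) : (S : Set Γ) ^ n ⊆ ⋃ i ∈ Finset.range d, (S : Set Γ) ^ i := by
    intro h hh
    by_contra hnot
    obtain ⟨k, hk, hk'⟩ := leftSum_pow_deltaOne_apply S n h
    obtain ⟨c, hc⟩ := hpow n
    have h0 : (leftSum S ^ n) (deltaOne Γ) h = 0 := by
      rw [hc, _root_.sum_apply, lp.coeFn_sum, Finset.sum_apply]
      refine Finset.sum_eq_zero fun i hi => ?_
      obtain ⟨l, hl, hl'⟩ := leftSum_pow_deltaOne_apply S i h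
      have : l = 0 := by
        by_contra hl0
        exact hnot (Set.mem_biUnion hi (hl'.1 hl0))
      change c i • ((leftSum S ^ i) (deltaOne Γ) h) = 0
      rw [hl, this, Nat.cast_zero, smul_zero]
    rw [h0] at hk
    exact hk'.2 hh (Nat.cast_eq_zero.1 hk.symm)
  -- By symmetry of `S`, products of elements of `S` already exhaust the subgroup it generates,
  -- which would then be finite.
  have hclosure : (Subgroup.closure (S : Set Γ) : Set Γ) ⊆
      ⋃ i ∈ Finset.range d, (S : Set Γ) ^ i := by
    intro h hh
    suffices ∃ n, h ∈ (S : Set Γ) ^ n by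
      obtain ⟨n, hn⟩ := this
      exact hsub n hn
    induction hh using Subgroup.closure_induction_left with
    | one => exact ⟨0, by simp⟩
    | mul_left x hx y _ ih =>
      obtain ⟨n, hn⟩ := ih
      exact ⟨n + 1, by rw [pow_succ']; exact Set.mul_mem_mul hx hn⟩
    | inv_mul_cancel x hx y _ ih =>
      obtain ⟨n, hn⟩ := ih
      exact ⟨n + 1, by rw [pow_succ']; exact Set.mul_mem_mul (hinv x hx) hn⟩
  refine Set.infinite_coe_iff.1 hinf (Set.Finite.subset ?_ hclosure)
  classical
  exact Set.Finite.biUnion (Finset.finite_toSet _) fun i _ => by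
    rw [← Finset.coe_pow]
    exact Finset.finite_toSet _

end ClassSum

/-! ### Spectral projections of a self-adjoint operator -/

section RangeProjection

variable {H : Type*} [NormedAddCommGroup H] [InnerProductSpace ℂ H] [CompleteSpace H]

/-- The orthogonal projection onto the closure of the range of `T`. -/
def rangeProjection (T : H →L[ℂ] H) : H →L[ℂ] H := T.range.topologicalClosure.starProjection

theorem isStarProjection_rangeProjection (T : H →L[ℂ] H) : IsStarProjection (rangeProjection T) :=
  isStarProjection_starProjection

theorem rangeProjection_mul_self (T : H →L[ℂ] H) : rangeProjection T * T = T := by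
  ext x
  exact Submodule.starProjection_eq_self_iff.2
    (Submodule.le_topologicalClosure _ (LinearMap.mem_range_self _ x))

theorem rangeProjection_ne_zero {T : H →L[ℂ] H} (hT : T ≠ 0) : rangeProjection T ≠ 0 := by
  intro h
  apply hT
  rw [← rangeProjection_mul_self T, h, zero_mul]

theorem rangeProjection_mul_mul_eq {T A : H →L[ℂ] H} (h : Commute A T) :
    rangeProjection T * (A * rangeProjection T) = A * rangeProjection T := by
  ext x
  refine Submodule.starProjection_eq_self_iff.2 ?_
  change A (rangeProjection T x) ∈ closure (T.range : Set H)
  have hx : rangeProjection T x ∈ closure (T.range : Set H) :=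
    Submodule.starProjection_apply_mem T.range.topologicalClosure x
  refine map_mem_closure A.continuous hx ?_
  rintro _ ⟨y, rfl⟩
  exact ⟨A y, congrArg (fun B => B y) h.eq.symm⟩

/-- Both `A` and `A*` preserve the closed range, so with `P` its projection `PAP = AP` and, by
adjoints, `PAP = PA`. -/
theorem commute_rangeProjection {T A : H →L[ℂ] H} (h : Commute A T) (h' : Commute (star A) T) :
    Commute A (rangeProjection T) := by
  have h1 := rangeProjection_mul_mul_eq h
  have h2 := congrArg star (rangeProjection_mul_mul_eq h')
  rw [star_mul, star_mul, star_star, (isStarProjection_rangeProjection T).isSelfAdjoint.star_eq,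
    mul_assoc, h1] at h2
  exact h2

theorem inner_rangeProjection_eq_zero {T R : H →L[ℂ] H} (hT : IsSelfAdjoint T) (h : T * R = 0)
    (x y : H) : inner ℂ (rangeProjection T x) (rangeProjection R y) = 0 := by
  have hle : T.range.topologicalClosure ⟂ R.range.topologicalClosure := by
    refine Submodule.topologicalClosure_minimal _ ?_ (Submodule.isClosed_orthogonal _)
    rw [Submodule.orthogonal_closure]
    rintro _ ⟨u, rfl⟩
    rw [Submodule.mem_orthogonal']
    rintro _ ⟨v, rfl⟩
    have h1 := ContinuousLinearMap.adjoint_inner_left T (R v) u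
    rw [← ContinuousLinearMap.star_eq_adjoint, hT.star_eq] at h1
    exact h1.trans (by rw [← mul_apply_eq_comp, h, zero_apply, inner_zero_right])
  exact hle.inner_eq (Submodule.starProjection_apply_mem _ x)
    (Submodule.starProjection_apply_mem _ y)

/-- Bessel's inequality for pairwise orthogonal projections. -/
theorem sum_norm_sq_le_of_orthogonal {ι : Type*} (s : Finset ι) {p : ι → H →L[ℂ] H}
    (hp : ∀ i, IsStarProjection (p i))
    (horth : ∀ i j, i ≠ j → ∀ x y, inner ℂ (p i x) (p j y) = 0) (x : H) :
    ∑ i ∈ s, ‖p i x‖ ^ 2 ≤ ‖x‖ ^ 2 := by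
  classical
  have hself (i : ι) : inner ℂ x (p i x) = ((‖p i x‖ ^ 2 : ℝ) : ℂ) := by
    have h1 := ContinuousLinearMap.adjoint_inner_left (p i) (p i x) x
    rw [← ContinuousLinearMap.star_eq_adjoint, (hp i).isSelfAdjoint.star_eq,
      ← mul_apply_eq_comp, (hp i).isIdempotentElem.eq] at h1
    rw [← h1, inner_self_eq_norm_sq_to_K]
    norm_cast
  set v := ∑ i ∈ s, p i x with hv
  have h1 : inner ℂ x v = ((∑ i ∈ s, ‖p i x‖ ^ 2 : ℝ) : ℂ) := by
    rw [hv, inner_sum, Complex.ofReal_sum]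
    exact Finset.sum_congr rfl fun i _ => hself i
  have h2 : ‖v‖ ^ 2 = ∑ i ∈ s, ‖p i x‖ ^ 2 := by
    have : ((‖v‖ ^ 2 : ℝ) : ℂ) = ((∑ i ∈ s, ‖p i x‖ ^ 2 : ℝ) : ℂ) := by
      have h4 : inner ℂ v v = ((‖v‖ ^ 2 : ℝ) : ℂ) := by
        rw [inner_self_eq_norm_sq_to_K]
        norm_cast
      rw [← h4, hv, sum_inner, Complex.ofReal_sum]
      refine Finset.sum_congr rfl fun i hi => ?_
      rw [inner_sum, Finset.sum_eq_single i (fun j _ hj => horth i j hj.symm x x)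
        (fun h => (h hi).elim), inner_self_eq_norm_sq_to_K]
      norm_cast
    exact Complex.ofReal_injective this
  have h3 : ‖v‖ ^ 2 ≤ ‖x‖ * ‖v‖ := by
    have := norm_inner_le_norm (𝕜 := ℂ) x v
    rw [h1, ← h2, Complex.norm_real, Real.norm_of_nonneg (by positivity)] at this
    exact this
  rw [← h2]
  nlinarith [norm_nonneg v, norm_nonneg x]

/-- Finitely many distinct points have tent functions of disjoint supports. -/
theorem exists_continuous_disjoint (s : Finset ℝ) :
    ∃ f : ℝ → ℝ → ℝ, (∀ a, Continuous (f a)) ∧ (∀ a ∈ s, f a a ≠ 0) ∧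
      ∀ a ∈ s, ∀ b ∈ s, a ≠ b → ∀ x, f a x * f b x = 0 := by
  classical
  -- `δ` is half the least distance between distinct points, the radius at which the tents stop
  -- overlapping.
  obtain ⟨δ, hδ, hsep⟩ : ∃ δ > 0, ∀ a ∈ s, ∀ b ∈ s, a ≠ b → 2 * δ ≤ |a - b| := by
    rcases s.offDiag.eq_empty_or_nonempty with h0 | hne
    · refine ⟨1, one_pos, fun a ha b hb hab => ?_⟩
      have : (a, b) ∈ s.offDiag := Finset.mem_offDiag.2 ⟨ha, hb, hab⟩
      simp [h0] at this
    · obtain ⟨⟨u, v⟩, huv, hmin⟩ := s.offDiag.exists_min_image (fun c => |c.1 - c.2|) hne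
      refine ⟨|u - v| / 2, half_pos (abs_pos.2 (sub_ne_zero.2 (Finset.mem_offDiag.1 huv).2.2)),
        fun a ha b hb hab => ?_⟩
      have := hmin (a, b) (Finset.mem_offDiag.2 ⟨ha, hb, hab⟩)
      dsimp only at this
      linarith
  refine ⟨fun a x => max 0 (δ - |x - a|), fun a => by fun_prop, fun a _ => ?_,
    fun a ha b hb hab x => ?_⟩
  · simp [hδ.ne', hδ.le]
  · change max 0 (δ - |x - a|) * max 0 (δ - |x - b|) = 0
    have h1 := hsep a ha b hb hab
    have h2 := abs_sub_le a x b
    rw [abs_sub_comm a x] at h2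
    rcases le_total δ |x - a| with h | h
    · simp [h]
    · rw [max_eq_left (a := 0) (b := δ - |x - b|) (by linarith), mul_zero]

/-- The polynomial `q` with the spectrum as its simple roots kills `T`, so each `X ^ n` may be
replaced by its remainder modulo `q`. -/
theorem exists_powers_mem_span_of_finite_spectrum {T : H →L[ℂ] H} (hT : IsSelfAdjoint T)
    (hfin : (spectrum ℝ T).Finite) :
    ∃ d : ℕ, ∀ n, ∃ c : ℕ → ℂ, T ^ n = ∑ i ∈ Finset.range d, c i • T ^ i := by
  set q : Polynomial ℝ := ∏ s ∈ hfin.toFinset, (Polynomial.X - Polynomial.C s) with hq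
  have hmonic : q.Monic := Polynomial.monic_prod_of_monic _ _ fun s _ => Polynomial.monic_X_sub_C s
  have hzero : Polynomial.aeval T q = 0 := by
    rw [← cfc_polynomial q T hT, ← cfc_zero ℝ T]
    refine cfc_congr fun s hs => ?_
    rw [hq, Polynomial.eval_prod]
    exact Finset.prod_eq_zero (hfin.mem_toFinset.2 hs) (by simp)
  refine ⟨q.natDegree, fun n => ?_⟩
  have h1 := Polynomial.aeval_modByMonic_eq_self_of_root (p := Polynomial.X ^ n) hzero
  rw [map_pow, Polynomial.aeval_X] at h1
  refine ⟨fun i => ((Polynomial.X ^ n %ₘ q).coeff i : ℝ), ?_⟩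
  simp_rw [Complex.coe_smul]
  rw [← h1]
  by_cases hq1 : q = 1
  · simp [hq1]
  · exact Polynomial.aeval_eq_sum_range' (Polynomial.natDegree_modByMonic_lt _ hmonic hq1) _

/-- Tents at `n` spectral points give operators with pairwise zero products, each nonzero by
spectral mapping. Their range projections avoid Borel functional calculus. -/
theorem exists_orthogonal_projections_of_infinite_spectrum {T : H →L[ℂ] H} (hT : IsSelfAdjoint T)
    (hinf : (spectrum ℝ T).Infinite) (n : ℕ) :
    ∃ p : Fin n → H →L[ℂ] H, (∀ i, IsStarProjection (p i)) ∧ (∀ i, p i ≠ 0) ∧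
      (∀ i j, i ≠ j → ∀ x y, inner ℂ (p i x) (p j y) = 0) ∧
      ∀ A, Commute A T → Commute (star A) T → ∀ i, Commute A (p i) := by
  obtain ⟨s, hs, hcard⟩ := hinf.exists_subset_card_eq n
  obtain ⟨f, hf, hne, hdisj⟩ := exists_continuous_disjoint s
  let e : Fin n ≃ s := (s.equivFinOfCardEq hcard).symm
  refine ⟨fun i => rangeProjection (cfc (f (e i)) T), fun i => isStarProjection_rangeProjection _,
    fun i => rangeProjection_ne_zero fun h0 => ?_, fun i j hij x y => ?_, fun A hA hA' i => ?_⟩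
  · have h1 : f (e i) (e i) ∈ spectrum ℝ (cfc (f (e i)) T) := by
      rw [cfc_map_spectrum (f (e i)) T hT (hf _).continuousOn]
      exact ⟨e i, hs (e i).2, rfl⟩
    rw [h0] at h1
    rcases subsingleton_or_nontrivial (H →L[ℂ] H) with h | h
    · simp at h1
    · rw [spectrum.zero_eq] at h1
      exact hne _ (e i).2 h1
  · refine inner_rangeProjection_eq_zero (cfc_predicate _ _) ?_ x y
    rw [← cfc_mul _ _ T (hf _).continuousOn (hf _).continuousOn, ← cfc_zero ℝ T]
    exact cfc_congr fun x _ => hdisj _ (e i).2 _ (e j).2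
      (Subtype.coe_ne_coe.2 (e.injective.ne hij)) x
  · exact commute_rangeProjection (hA.symm.cfc_real _).symm (hA'.symm.cfc_real _).symm

end RangeProjection

/-! ### Vanishing granularity -/

section InfiniteFCCenter

variable {Γ : Type*} [Group Γ]

theorem norm_sq_mem_centralTraces {p : GroupL2 Γ →L[ℂ] GroupL2 Γ}
    (hp : p ∈ vnCenter (groupVN Γ)) (hproj : IsStarProjection p) (h0 : p ≠ 0) :
    ‖p (deltaOne Γ)‖ ^ 2 ∈ centralTraces Γ :=
  ⟨p, hp, hproj, h0, groupTrace_proj hproj⟩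

theorem centralGranularity_le {r : ℝ} (hr : r ∈ centralTraces Γ) : centralGranularity Γ ≤ r :=
  csInf_le ⟨0, fun _ h => centralTraces_nonneg h⟩ hr

theorem centralGranularity_nonneg : 0 ≤ centralGranularity Γ :=
  Real.sInf_nonneg fun _ h => centralTraces_nonneg h

theorem centralGranularity_eq_zero_of_not_powers_mem_span {T : GroupL2 Γ →L[ℂ] GroupL2 Γ}
    (hT : T ∈ vnCenter (groupVN Γ)) (hsa : IsSelfAdjoint T)
    (hpow : ¬ ∃ d : ℕ, ∀ n, ∃ c : ℕ → ℂ, T ^ n = ∑ i ∈ Finset.range d, c i • T ^ i) :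
    centralGranularity Γ = 0 := by
  refine le_antisymm (le_of_forall_pos_le_add fun ε hε => ?_) centralGranularity_nonneg
  obtain ⟨n, hn⟩ := exists_nat_gt (1 / ε)
  obtain ⟨p, hproj, hne, horth, hcomm⟩ := exists_orthogonal_projections_of_infinite_spectrum hsa
    (fun h => hpow (exists_powers_mem_span_of_finite_spectrum hsa h)) n
  have hbessel := sum_norm_sq_le_of_orthogonal Finset.univ hproj horth (deltaOne Γ)
  rw [norm_deltaOne, one_pow] at hbessel
  rw [mem_vnCenter_groupVN_iff] at hT
  have hcentral (i : Fin n) : p i ∈ vnCenter (groupVN Γ) := by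
    refine mem_vnCenter_groupVN_iff.2 ⟨mem_leftCommutant_iff.2 fun g => hcomm _ ?_ ?_ i,
      fun y hy => hcomm y (hT.2 y hy) (hT.2 _ (star_mem hy)) i⟩
    · exact mem_leftCommutant_iff.1 hT.1 g
    · rw [star_leftRegular]
      exact mem_leftCommutant_iff.1 hT.1 g⁻¹
  -- Each of the `n` traces is at least the granularity and they total at most `1`, while `n > 1/ε`.
  have hsum : ∑ _i : Fin n, centralGranularity Γ ≤ ∑ i, ‖p i (deltaOne Γ)‖ ^ 2 :=
    Finset.sum_le_sum fun i _ => centralGranularity_le <|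
      norm_sq_mem_centralTraces (hcentral i) (hproj i) (hne i)
  rw [Finset.sum_const, Finset.card_univ, Fintype.card_fin, nsmul_eq_mul] at hsum
  rw [div_lt_iff₀ hε] at hn
  by_contra! hlt
  rw [zero_add] at hlt
  have : (n : ℝ) * ε ≤ n * centralGranularity Γ := by gcongr
  linarith

theorem centralGranularity_eq_zero_of_fg {Λ : Subgroup Γ} (hΛ : Λ ≤ fcCenter Γ) (hfg : Λ.FG)
    (hinf : Infinite Λ) : centralGranularity Γ = 0 := by
  classical
  obtain ⟨s, rfl⟩ := hfg
  have hfin : (⋃ a ∈ s, (conjugatesOf a ∪ (conjugatesOf a)⁻¹)).Finite :=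
    Set.Finite.biUnion s.finite_toSet fun a ha =>
      have h : (conjugatesOf a).Finite := hΛ (Subgroup.subset_closure ha)
      h.union h.inv
  obtain ⟨S, hS⟩ := hfin.exists_finset_coe
  have hmem (x : Γ) : x ∈ S ↔ ∃ a ∈ s, IsConj a x ∨ IsConj a x⁻¹ := by
    rw [← Finset.mem_coe, hS]
    simp [conjugatesOf]
  have hinv : ∀ x ∈ S, x⁻¹ ∈ S := by
    intro x hx
    obtain ⟨a, ha, h⟩ := (hmem x).1 hx
    exact (hmem _).2 ⟨a, ha, by rw [inv_inv]; exact h.symm⟩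
  have hconj : ∀ g, ∀ x ∈ S, g * x * g⁻¹ ∈ S := by
    intro g x hx
    obtain ⟨a, ha, h⟩ := (hmem x).1 hx
    refine (hmem _).2 ⟨a, ha, h.imp (fun h => h.trans (isConj_iff.2 ⟨g, rfl⟩))
      (fun h => h.trans (isConj_iff.2 ⟨g, by group⟩))⟩
  refine centralGranularity_eq_zero_of_not_powers_mem_span (leftSum_mem_vnCenter hconj)
    (isSelfAdjoint_leftSum hinv) (not_powers_mem_span_leftSum hinv ?_)
  refine Set.infinite_coe_iff.2 (Set.Infinite.mono ?_ (Set.infinite_coe_iff.1 hinf))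
  exact Subgroup.closure_mono fun a ha => (hmem a).2 ⟨a, ha, Or.inl (IsConj.refl a)⟩

end InfiniteFCCenter

/-! ### Granularity for a finite FC-centre -/

section FiniteFCCenter

variable {Γ : Type*} [Group Γ]

theorem centralTraces_lower_bound [Finite (fcCenter Γ)] {r : ℝ} (hr : r ∈ centralTraces Γ) :
    1 / (Nat.card (fcCenter Γ) : ℝ) ≤ r := by
  classical
  obtain ⟨p, hp, hproj, hp0, htr⟩ := hr
  rw [groupTrace_proj hproj] at htr
  have hr : ‖p (deltaOne Γ)‖ ^ 2 = r := Complex.ofReal_injective htr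
  rw [mem_vnCenter_groupVN_iff] at hp
  set ξ := p (deltaOne Γ) with hξ
  have hright (g : Γ) : p (rightRegular g (deltaOne Γ)) = rightRegular g ξ :=
    congrArg (fun B => B (deltaOne Γ)) (hp.2 _ (rightRegular_mem_leftCommutant g)).eq.symm
  have hadj (η ζ : GroupL2 Γ) : inner ℂ (p η) ζ = inner ℂ η (p ζ) := by
    have h := ContinuousLinearMap.adjoint_inner_left p ζ η
    rwa [← ContinuousLinearMap.star_eq_adjoint, hproj.isSelfAdjoint.star_eq] at h
  have hpξ : p ξ = ξ := congrArg (fun B => B (deltaOne Γ)) hproj.isIdempotentElem.eq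
  -- `δ_e` is fixed by `λ_{g⁻¹} ρ_{g⁻¹}`, which commutes with `p`, so `ξ` is fixed too.
  have hclass (g h : Γ) : ξ (g * h * g⁻¹) = ξ h := by
    have h1 := congrArg (fun B => B (rightRegular g⁻¹ (deltaOne Γ)))
      (mem_leftCommutant_iff.1 hp.1 g⁻¹).eq
    have h2 : leftRegular Γ g⁻¹ (rightRegular g⁻¹ (deltaOne Γ)) = deltaOne Γ := by
      ext k
      rw [leftRegular_apply, rightRegular_apply, deltaOne_apply, deltaOne_apply]
      simp [mul_inv_eq_one]
    have h3 : leftRegular Γ g⁻¹ (rightRegular g⁻¹ ξ) = ξ := by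
      rw [← hright, hξ]
      exact h1.trans (congrArg p h2)
    conv_rhs => rw [← h3, leftRegular_apply, rightRegular_apply, inv_inv]
  have hsupp (h : Γ) (hh : ξ h ≠ 0) : h ∈ fcCenter Γ := by
    have hsum : Summable fun k => ‖ξ k‖ ^ (2 : ℝ≥0∞).toReal :=
      (memℓp_gen_iff (by norm_num)).1 (lp.memℓp ξ)
    -- Only finitely many points carry a value as large as `|ξ(h)|`, yet the whole class of `h`
    -- does.
    have hev := hsum.tendsto_cofinite_zero.eventually_lt_const
      (u := ‖ξ h‖ ^ (2 : ℝ≥0∞).toReal) (by positivity)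
    refine Set.Finite.subset (Filter.eventually_cofinite.1 hev) ?_
    intro x hx
    obtain ⟨c, rfl⟩ := isConj_iff.1 (show IsConj h x from hx)
    simp [hclass]
  have hbound (g : Γ) : ‖ξ g‖ ≤ ‖ξ‖ ^ 2 := by
    rw [← inner_rightRegular_deltaOne, ← hpξ, ← hadj, hright, hpξ]
    refine (norm_inner_le_norm _ _).trans_eq ?_
    rw [norm_rightRegular, sq]
  -- The right translates of `δ_e` determine every coefficient of `p η`, so `p δ_e = 0` would force
  -- `p = 0`.
  have hξ0 : ξ ≠ 0 := by
    intro h0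
    apply hp0
    ext η g
    change p η g = 0
    rw [← inner_rightRegular_deltaOne, ← hadj, hright, h0, map_zero, inner_zero_left]
  have hnorm : ‖ξ‖ ^ 2 = ∑' h : fcCenter Γ, ‖ξ h‖ ^ 2 := by
    have h2 := lp.norm_rpow_eq_tsum (p := 2) (by norm_num) ξ
    simp only [ENNReal.toReal_ofNat, Real.rpow_ofNat] at h2
    exact h2.trans (tsum_subtype_eq_of_support_subset (s := (fcCenter Γ : Set Γ))
      (f := fun h => ‖ξ h‖ ^ 2) fun h hh => hsupp h fun h0 => hh (by simp [h0])).symm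
  have := Fintype.ofFinite (fcCenter Γ)
  rw [tsum_fintype] at hnorm
  have hle : ‖ξ‖ ^ 2 ≤ Nat.card (fcCenter Γ) * (‖ξ‖ ^ 2) ^ 2 := by
    calc ‖ξ‖ ^ 2 ≤ ∑ _h : fcCenter Γ, (‖ξ‖ ^ 2) ^ 2 :=
          hnorm.trans_le (Finset.sum_le_sum fun h _ => by gcongr; exact hbound h)
      _ = _ := by simp
  have hpos : 0 < ‖ξ‖ ^ 2 := by positivity
  have hn : 0 < (Nat.card (fcCenter Γ) : ℝ) := by exact_mod_cast Nat.card_pos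
  rw [← hr, div_le_iff₀ hn]
  nlinarith

theorem one_div_card_mem_centralTraces [Finite (fcCenter Γ)] :
    1 / (Nat.card (fcCenter Γ) : ℝ) ∈ centralTraces Γ := by
  classical
  have hmemS (x : Γ) : x ∈ (Set.toFinite (fcCenter Γ : Set Γ)).toFinset ↔ x ∈ fcCenter Γ := by simp
  set S := (Set.toFinite (fcCenter Γ : Set Γ)).toFinset
  have hcard : S.card = Nat.card (fcCenter Γ) := (Nat.card_eq_card_finite_toFinset _).symm
  have hn : (Nat.card (fcCenter Γ) : ℂ) ≠ 0 := Nat.cast_ne_zero.2 Nat.card_pos.ne'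
  set c : ℂ := (Nat.card (fcCenter Γ) : ℂ)⁻¹ with hc
  have hcentral : leftSum S ∈ vnCenter (groupVN Γ) := leftSum_mem_vnCenter fun g x hx =>
    (hmemS _).2 <| by
      have h : (conjugatesOf x).Finite := (hmemS x).1 hx
      change (conjugatesOf _).Finite
      rwa [← IsConj.conjugatesOf_eq (isConj_iff.2 ⟨g, rfl⟩)]
  have hinv : ∀ x ∈ S, x⁻¹ ∈ S := fun x hx => (hmemS _).2 (inv_mem ((hmemS x).1 hx))
  -- Left multiplication by an element of `S` permutes the subgroup `S`, so each of the `|S|` terms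
  -- reproduces the sum.
  have hsq : leftSum S * leftSum S = (Nat.card (fcCenter Γ) : ℂ) • leftSum S := by
    have h1 (x : Γ) (hx : x ∈ S) : leftRegular Γ x * leftSum S = leftSum S := by
      rw [leftSum, Finset.mul_sum]
      refine Finset.sum_nbij' (fun y => x * y) (fun y => x⁻¹ * y)
        (fun y hy => (hmemS _).2 (mul_mem ((hmemS x).1 hx) ((hmemS y).1 hy)))
        (fun y hy => (hmemS _).2 (mul_mem (inv_mem ((hmemS x).1 hx)) ((hmemS y).1 hy)))
        (fun y _ => by group) (fun y _ => by group) fun y _ => (map_mul _ x y).symm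
    have h2 : leftSum S * leftSum S = ∑ x ∈ S, leftRegular Γ x * leftSum S := Finset.sum_mul ..
    rw [h2, Finset.sum_congr rfl h1, Finset.sum_const, hcard, Nat.cast_smul_eq_nsmul]
  have hproj : IsStarProjection (c • leftSum S) := by
    constructor
    · rw [IsIdempotentElem, smul_mul_smul_comm, hsq, smul_smul, hc, mul_assoc,
        inv_mul_cancel₀ hn, mul_one]
    · rw [IsSelfAdjoint, star_smul, (isSelfAdjoint_leftSum hinv).star_eq, hc]
      simp
  have htrace : groupTrace (c • leftSum S) = ((1 / (Nat.card (fcCenter Γ) : ℝ) : ℝ) : ℂ) := by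
    have h1 := inner_rightRegular_deltaOne (1 : Γ) ((c • leftSum S) (deltaOne Γ))
    have h2 : rightRegular (1 : Γ)⁻¹ (deltaOne Γ) = deltaOne Γ := by
      ext k
      rw [rightRegular_apply, inv_one, mul_one]
    rw [h2] at h1
    rw [groupTrace, h1]
    change c * (leftSum S (deltaOne Γ) 1) = _
    rw [leftSum_apply]
    simp_rw [deltaOne_apply]
    simp [hmemS, one_mem, hc]
  refine ⟨_, SMulMemClass.smul_mem c hcentral, hproj, fun h0 => ?_, htrace⟩
  rw [h0, groupTrace] at htrace
  simp only [zero_apply, inner_zero_right, one_div, Complex.ofReal_inv, Complex.ofReal_natCast]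
    at htrace
  exact inv_ne_zero hn htrace.symm

end FiniteFCCenter
end

theorem mainTheorem5 (Γ : Type*) [Group Γ] :
    (Finite (fcCenter Γ) → centralGranularity Γ = 1 / (Nat.card (fcCenter Γ) : ℝ)) ∧
    ((∃ Λ : Subgroup Γ, Λ ≤ fcCenter Γ ∧ Λ.FG ∧ Infinite Λ) → centralGranularity Γ = 0) := by
  refine ⟨fun _ => ?_, fun ⟨Λ, hΛ, hfg, hinf⟩ => centralGranularity_eq_zero_of_fg hΛ hfg hinf⟩
  exact le_antisymm (centralGranularity_le one_div_card_mem_centralTraces)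
    (le_csInf ⟨1, one_mem_centralTraces Γ⟩ fun r hr => centralTraces_lower_bound hr)
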